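/- **Setting.** Let $T$ be a finite rooted ordered tree whose leaves are pairwise distinct data points and whose internal nodes each have at least one child. Let $D$ be the set of its data points. Let $Q$ be a query point, $k\ge 1$ an integer and $Sim(\cdot,\cdot)$ a real-valued similarity of points. An *entry* is an internal node or a single point. We write $e\in E$ if $e$ is a point in the subtree of $E$ (with $\{Q\}$ the only point of the entry $Q$), and $|E|$ for the number of points of $E$. Two entries *overlap* if they share a point. The algorithm is given real numbers $MinSim(E,F)$, $MaxSim(E,F)$ that are *valid bounds*: for every entry $E$ of $T$ and every $F$ that is an entry of $T$ or the query $Q$, $$MinSim(E,F)\le Sim(e,f)\le MaxSim(E,F)\qquad\text{for all } e\in E,\ f\in F .$$ The reverse $k$-nearest-neighbour set of $Q$ (ties broken in favour of data points) is $$R_k(Q)=\bigl\{e\in D:\ \#\{y\in D\setminus\{e\}: Sim(e,y)\ge Sim(e,Q)\}<k\bigr\}.$$ **NN-lists.** Each entry $E$ carries a lower list $NN_L(E)$ and an upper list $NN_U(E)$, initially empty, of pairs $(F,m)$ with $F$ an entry and $m\in\mathbb N$, kept in decreasing order of $MinSim(E,F)$ and of $MaxSim(E,F)$, respectively. *Updating*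 $E$ with $F$ means: in both lists of $E$ remove every pair whose entry overlaps $F$, and insert $(F,m)$, where $m=|F|-1$ if $E$ and $F$ overlap and $m=|F|$ otherwise. For such a list, its $k$-th entry is the entry at the smallest index $i$ with $k\le m_1+\dots+m_i$, if there is one. An entry $E$ is a *hit* if $MinSim(E,Q)>MaxSim(E,F)$ for the $k$-th entry $F$ of $NN_U(E)$ (or there is no $k$-th entry). Otherwise $E$ is a *drop* if $NN_L(E)$ has a $k$-th entry $F$ and $MaxSim(E,Q)\le MinSim(E,F)$. **Algorithm.** There is a FIFO queue $U$, initially containing only the root, and lists $COL$, $ROL$, $PEL$ (candidates, results, pruned), initially empty. While $U\neq\emptyset$, dequeue an entry $E$ and do the following. 1. Remove $E$ and the parent of $E$ from both NN-lists of $E$. 2. If $E$ is an internal node, update $E$ with $E$. 3. For each $F$ in $U$, update $E$ with $F$ and $F$ with $E$. 4. If $E$ is a hit, append all points of $E$ to $ROL$. If it is a drop, append $E$ to $PEL$. Otherwise, if $E$ is an internal node, each child of $E$ copies the NN-lists of $E$ (re-sorted for the child) and is enqueued, and if $E$ is a point, append it to $COL$. When $U=\emptyset$, run *Final_Verification*.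 First replace the entries in $PEL$ by the points they contain. Then, while $COL\ne\emptyset$, for each $o$ in $COL$: update $o$ with every point of $ROL$, of $PEL$ and of $COL\setminus\{o\}$. If $o$ is then a hit, move it from $COL$ to $ROL$. If it is a drop, move it from $COL$ to $PEL$. The algorithm returns the set of points in $ROL$. **Theorem.** For all such $T$, $Q$, $k\ge1$, $Sim$ and all valid bounds $MinSim$, $MaxSim$: 1. if the algorithm halts, the set that it returns is exactly $R_k(Q)$; 2. if moreover the bounds are exact between single points, that is, $MinSim(e,f)=Sim(e,f)=MaxSim(e,f)$ for all $e\in D$ and $f\in D\cup\{Q\}$, then the algorithm halts and returns $R_k(Q)$. -/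

import Mathlib

namespace RkNN

/-- An entry of an index: a data point (leaf) or an internal node. `X` is the type of all points
(database objects and query points), `I` the type of internal nodes. -/
inductive Entry (X I : Type*) where
  | point (x : X) : Entry X I
  | inner (i : I) : Entry X I

/-- A hierarchical index: a rooted ordered tree whose leaves are the data points themselves.
Every internal node has at least one child, every entry has at most one parent, the root has
none, and every internal node is reached from the root. -/
structure IndexTree (X I : Type*) where
  root : Entry X I
  children : I → List (Entry X I)
  children_ne_nil : ∀ i, children i ≠ []
  children_nodup : ∀ i, (children i).Nodup
  parent_unique : ∀ i j E, E ∈ children i → E ∈ children j → i = j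
  root_not_child : ∀ i, root ∉ children i
  reachable : ∀ i, Relation.ReflTransGen
    (fun E F : Entry X I => ∃ j, E = Entry.inner j ∧ F ∈ children j) root (Entry.inner i)

namespace IndexTree

variable {X I : Type*} (T : IndexTree X I)

/-- `E` is the parent of `F`. -/
def IsParent (E F : Entry X I) : Prop :=
  ∃ i, E = Entry.inner i ∧ F ∈ T.children i

/-- `F` lies in the subtree of `E` (possibly `F = E`). -/
def InSubtree (E F : Entry X I) : Prop :=
  Relation.ReflTransGen T.IsParent E F

/-- `E` is an entry (internal node or data point) of the tree. -/
def IsEntry (E : Entry X I) : Prop :=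
  T.InSubtree T.root E

/-- The points contained in an entry; for a single point `x` this is `{x}`. -/
def points (E : Entry X I) : Set X :=
  {x | T.InSubtree E (Entry.point x)}

/-- The database: all points stored in the tree. -/
def data : Set X :=
  T.points T.root

/-- Two entries overlap if they share a point. -/
def Overlap (E F : Entry X I) : Prop :=
  (T.points E ∩ T.points F).Nonempty

theorem finite_points [Finite I] (E : Entry X I) : (T.points E).Finite := by
  have hinj : Function.Injective (Entry.point : X → Entry X I) :=
    fun a b h => by injection h
  have h : (({E} : Set (Entry X I)) ∪ ⋃ i, {F | F ∈ T.children i}).Finite :=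
    (Set.finite_singleton E).union (Set.finite_iUnion fun i => List.finite_toSet (T.children i))
  refine (h.preimage hinj.injOn).subset ?_
  intro x hx
  rcases Relation.ReflTransGen.cases_tail hx with h1 | ⟨F, -, i, -, hi⟩
  · exact Or.inl h1
  · exact Or.inr (Set.mem_iUnion.2 ⟨i, hi⟩)

/-- The points contained in an entry, listed without repetition. -/
noncomputable def pointList [Finite I] (E : Entry X I) : List X :=
  (T.finite_points E).toFinset.toList

/-- The number `|E|` of points contained in an entry. -/
noncomputable def size (E : Entry X I) : ℕ :=
  (T.points E).ncard

end IndexTree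

/-- The reverse `k`-nearest-neighbour set of `Q` in the database `D`: the data points `e` such that
`Q` is among the `k` nearest neighbours of `e`, ties being broken in favour of data points, that
is, fewer than `k` data points other than `e` are at least as similar to `e` as `Q` is. -/
def reverseKNN {X : Type*} (Sim : X → X → ℝ) (D : Set X) (k : ℕ) (Q : X) : Set X :=
  {e | e ∈ D ∧ {y | y ∈ D ∧ y ≠ e ∧ Sim e Q ≤ Sim e y}.ncard < k}

/-- What the algorithm is given. It sees similarities only through the estimates
`minSim` and `maxSim` between entries (the query being a single point). -/
structure Input (X I : Type*) where
  tree : IndexTree X I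
  k : ℕ
  query : X
  minSim : Entry X I → Entry X I → ℝ
  maxSim : Entry X I → Entry X I → ℝ

/-- An NN-list: a list of entries with multiplicities. -/
abbrev NNList (X I : Type*) := List (Entry X I × ℕ)

/-- The data structures of the algorithm: the FIFO queue `U` (first entry first), the candidate,
result and pruned lists, and the lower and upper NN-list of every entry. -/
structure State (X I : Type*) where
  U : List (Entry X I)
  COL : List X
  ROL : List X
  PEL : List (Entry X I)
  NNL : Entry X I → NNList X I
  NNU : Entry X I → NNList X I

/-- The entry at the smallest index `i` with `k ≤ m₁ + ⋯ + mᵢ` (for `k ≥ 1`), if there is one. -/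
def kthEntry {X I : Type*} : ℕ → NNList X I → Option (Entry X I)
  | _, [] => none
  | k, (E, m) :: l => if k ≤ m then some E else kthEntry (k - m) l

namespace Input

variable {X I : Type*} (P : Input X I)

/-- For entries `E` of the tree and `F` that are entries of the tree or the query point,
`minSim E F` and `maxSim E F` bound `Sim e f` for all points `e` of `E` and `f` of `F`. -/
def ValidBounds (Sim : X → X → ℝ) : Prop :=
  ∀ E F, P.tree.IsEntry E → (P.tree.IsEntry F ∨ F = Entry.point P.query) →
    ∀ e ∈ P.tree.points E, ∀ f ∈ P.tree.points F,
      P.minSim E F ≤ Sim e f ∧ Sim e f ≤ P.maxSim E F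

/-- Between single points (a data point, and a data point or the query) both estimates
are the similarity itself. -/
def ExactOnPoints (Sim : X → X → ℝ) : Prop :=
  ∀ e ∈ P.tree.data, ∀ f, (f ∈ P.tree.data ∨ f = P.query) →
    P.minSim (Entry.point e) (Entry.point f) = Sim e f ∧
      P.maxSim (Entry.point e) (Entry.point f) = Sim e f

open Classical in
/-- Sort an NN-list of `E` in decreasing order of `sim E ·`. -/
noncomputable def sortFor (sim : Entry X I → Entry X I → ℝ) (E : Entry X I)
    (l : NNList X I) : NNList X I :=
  l.insertionSort (fun a b => sim E b.1 ≤ sim E a.1)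

open Classical in
/-- The multiplicity of `F` in an NN-list of `E`. -/
noncomputable def multiplicity (E F : Entry X I) : ℕ :=
  if P.tree.Overlap E F then P.tree.size F - 1 else P.tree.size F

open Classical in
/-- Enter `F` into a sorted NN-list of `E`; it replaces the listed entries that overlap with `F`
(an earlier copy of `F`, or a node whose subtree contains `F`). -/
noncomputable def insertEntry (sim : Entry X I → Entry X I → ℝ) (E F : Entry X I)
    (l : NNList X I) : NNList X I :=
  sortFor sim E ((F, P.multiplicity E F) :: l.filter (fun t => ¬ P.tree.Overlap t.1 F))

open Classical in
/-- `Update_NN-list(E, F)`: update both NN-lists of `E` with `F`. -/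
noncomputable def update (E F : Entry X I) (s : State X I) : State X I :=
  { s with
    NNL := Function.update s.NNL E (P.insertEntry P.minSim E F (s.NNL E))
    NNU := Function.update s.NNU E (P.insertEntry P.maxSim E F (s.NNU E)) }

open Classical in
/-- Remove `E` and the parent of `E` from the NN-lists of `E`. -/
noncomputable def removeParent (E : Entry X I) (s : State X I) : State X I :=
  { s with
    NNL := Function.update s.NNL E
      ((s.NNL E).filter (fun t => ¬ (t.1 = E ∨ P.tree.IsParent t.1 E)))
    NNU := Function.update s.NNU E
      ((s.NNU E).filter (fun t => ¬ (t.1 = E ∨ P.tree.IsParent t.1 E))) }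

/-- Locality: an internal node enters itself into its own NN-lists. -/
noncomputable def addSelf (E : Entry X I) (s : State X I) : State X I :=
  match E with
  | Entry.point _ => s
  | Entry.inner _ => P.update E E s

/-- Completeness: `E` and every entry `F` of the queue update their NN-lists with each other. -/
noncomputable def mutualEffect (E : Entry X I) (s : State X I) : State X I :=
  s.U.foldl (fun s F => P.update F E (P.update E F s)) s

/-- Accepting condition: `MinSim(E, Q) > MaxSim(E, Eⱼ)`, where `Eⱼ` is the entry of the upper
NN-list of `E` at which the accumulated multiplicity reaches `k`. (If `k` is never reached, then
no point of `E` has `k` neighbours that could compete with `Q`, and the condition holds.) -/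
def IsHit (s : State X I) (E : Entry X I) : Prop :=
  ∀ F, kthEntry P.k (s.NNU E) = some F → P.maxSim E F < P.minSim E (Entry.point P.query)

/-- Pruning condition: `MaxSim(E, Q) ≤ MinSim(E, Eᵢ)`, where `Eᵢ` is the entry of the lower
NN-list of `E` at which the accumulated multiplicity reaches `k`. -/
def IsDrop (s : State X I) (E : Entry X I) : Prop :=
  ∃ F, kthEntry P.k (s.NNL E) = some F ∧ P.maxSim E (Entry.point P.query) ≤ P.minSim E F

open Classical in
/-- Enqueue the child `C` of `E`, which inherits the NN-lists of `E`. -/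
noncomputable def enqueueChild (E C : Entry X I) (s : State X I) : State X I :=
  { s with
    U := s.U ++ [C]
    NNL := Function.update s.NNL C (sortFor P.minSim C (s.NNL E))
    NNU := Function.update s.NNU C (sortFor P.maxSim C (s.NNU E)) }

/-- `E` is neither a hit nor a drop: an internal node is replaced by its children in the queue,
a point becomes a candidate. -/
noncomputable def expand (E : Entry X I) (s : State X I) : State X I :=
  match E with
  | Entry.point x => { s with COL := s.COL ++ [x] }
  | Entry.inner i => (P.tree.children i).foldl (fun s C => P.enqueueChild E C s) s

open Classical in
/-- The test of a dequeued entry: accept it (add its points to the results), prune it, or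
expand it. -/
noncomputable def testEntry [Finite I] (E : Entry X I) (s : State X I) : State X I :=
  if P.IsHit s E then { s with ROL := s.ROL ++ P.tree.pointList E }
  else if P.IsDrop s E then { s with PEL := s.PEL ++ [E] }
  else P.expand E s

/-- One iteration of the main loop, with `E` dequeued and `rest` the remaining queue. -/
noncomputable def mainBody [Finite I] (E : Entry X I) (rest : List (Entry X I))
    (s : State X I) : State X I :=
  P.testEntry E (P.mutualEffect E (P.addSelf E (P.removeParent E { s with U := rest })))

/-- `MainLoop s t`: started in `s`, the main loop (while the queue is non-empty) stops in `t`. -/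
inductive MainLoop [Finite I] : State X I → State X I → Prop
  | done (s : State X I) (h : s.U = []) : MainLoop s s
  | iter (s t : State X I) (E : Entry X I) (rest : List (Entry X I)) (h : s.U = E :: rest)
      (ht : MainLoop (P.mainBody E rest s) t) : MainLoop s t

/-- `PEL = SubTree(PEL)`: replace the pruned entries by the points they contain. -/
noncomputable def flattenPEL [Finite I] (s : State X I) : State X I :=
  { s with PEL := s.PEL.flatMap (fun E => (P.tree.pointList E).map Entry.point) }

open Classical in
/-- Update the NN-lists of the candidate `o` with all results, all pruned points and all other
candidates. -/
noncomputable def verifyUpdate (o : X) (s : State X I) : State X I :=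
  (s.ROL.map Entry.point ++ s.PEL ++ (s.COL.filter (fun c => c ≠ o)).map Entry.point).foldl
    (fun s F => P.update (Entry.point o) F s) s

open Classical in
/-- The test of the candidate `o` in the verification: a hit moves to the results, a drop to the
pruned list, and otherwise `o` stays a candidate. -/
noncomputable def verifyTest (o : X) (s : State X I) : State X I :=
  if P.IsHit s (Entry.point o) then
    { s with ROL := s.ROL ++ [o], COL := s.COL.filter (fun c => c ≠ o) }
  else if P.IsDrop s (Entry.point o) then
    { s with PEL := s.PEL ++ [Entry.point o], COL := s.COL.filter (fun c => c ≠ o) }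
  else s

/-- One iteration of the verification loop: treat each current candidate once. -/
noncomputable def verifyPass (s : State X I) : State X I :=
  s.COL.foldl (fun s o => P.verifyTest o (P.verifyUpdate o s)) s

/-- `VerifyLoop s t`: started in `s`, the verification loop (while there are candidates) stops
in `t`. -/
inductive VerifyLoop : State X I → State X I → Prop
  | done (s : State X I) (h : s.COL = []) : VerifyLoop s s
  | iter (s t : State X I) (h : s.COL ≠ []) (ht : VerifyLoop (P.verifyPass s) t) :
      VerifyLoop s t

/-- Initially the root is enqueued and all lists are empty. -/
def initialState : State X I where
  U := [P.tree.root]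
  COL := []
  ROL := []
  PEL := []
  NNL := fun _ => []
  NNU := fun _ => []

/-- `P.Returns R`: the algorithm (main loop, then final verification) halts on the input `P`,
and the points in its result list are exactly those of `R`. -/
def Returns [Finite I] (R : Set X) : Prop :=
  ∃ s t, P.MainLoop P.initialState s ∧ P.VerifyLoop (P.flattenPEL s) t ∧ R = {x | x ∈ t.ROL}

end Input

end RkNN

namespace RkNN

/-! ### Ancestors, acyclicity and disjointness in the tree. -/

namespace IndexTree

variable {X I : Type*} (T : IndexTree X I)

/-! Every test on NN-lists is really a count of points. If the listed entries are disjoint and each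
multiplicity is the number of points of the entry other than `e`, for every `e` in `E`, then the
`k`-th entry has value at least `θ` exactly when the listed entries of value at least `θ` contain at
least `k` points other than `e` (`WellFormed.exists_kthEntry_iff`). With `θ = MinSim(E,Q)` in the
upper list this bounds the competitors of `Q` from above, provided that the list covers all data
points other than `e`; with `θ = MaxSim(E,Q)` in the lower list all counted points are competitors,
and no coverage is needed. So hits and drops are sound for every point of `E`.

It remains to see that coverage holds at each test, although updates evict entries. The queue always
consists of entries with disjoint subtrees. A data point is either still below a queue entry, and is
then covered by an update just before the test, or it is settled and already lies in an upper-list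
entry whose subtree is disjoint from that of every queue entry. Such an entry is never evicted and
is inherited by children (`MainInvariant`).

The main loop halts because the finite set of entries below the queue shrinks strictly. In the
verification every candidate is compared with all other data points individually; with exact point
similarities the two counts agree, so failing to be a hit means being a drop (`isHit_or_isDrop`) and
a single pass suffices. -/

theorem isParent_unique {E F G : Entry X I} (hE : T.IsParent E G) (hF : T.IsParent F G) :
    E = F := by
  obtain ⟨i, rfl, hi⟩ := hE
  obtain ⟨j, rfl, hj⟩ := hF
  rw [T.parent_unique i j G hi hj]

theorem inSubtree_root_inner (i : I) : T.InSubtree T.root (Entry.inner i) :=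
  T.reachable i

theorem not_isParent_root (E : Entry X I) : ¬ T.IsParent E T.root := by
  rintro ⟨i, -, h⟩
  exact T.root_not_child i h

/-- An entry on a path to `G` is a predecessor of the parent of `G`, unless it is `G` itself. -/
theorem inSubtree_of_isParent {E F G : Entry X I} (h : T.InSubtree E G) (hF : T.IsParent F G) :
    E = G ∨ T.InSubtree E F := by
  rcases Relation.ReflTransGen.cases_tail h with h | ⟨F', hE, hF'⟩
  · exact Or.inl h.symm
  · rw [T.isParent_unique hF hF']
    exact Or.inr hE

/-- The ancestors of an entry form a chain. -/
theorem inSubtree_total {E F G : Entry X I} (hE : T.InSubtree E G) (hF : T.InSubtree F G) :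
    T.InSubtree E F ∨ T.InSubtree F E := by
  induction hE with
  | refl => exact Or.inr hF
  | tail h1 h2 ih =>
    rcases T.inSubtree_of_isParent hF h2 with rfl | h
    · exact Or.inl (h1.tail h2)
    · exact ih h

/-- The tree has no cycles. -/
theorem not_inSubtree_of_isParent {E F : Entry X I} (h : T.IsParent E F) :
    ¬ T.InSubtree F E := by
  intro hc
  obtain ⟨i, rfl, hi⟩ := h
  have key : ∀ G, T.InSubtree T.root G → ∀ F, T.IsParent F G → ¬ T.InSubtree G F := by
    intro G hG
    induction hG with
    | refl => exact fun F hF => (T.not_isParent_root F hF).elim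
    | tail h1 h2 ih =>
      rename_i A B
      intro F hF hBF
      -- The parent on the cycle is the predecessor on the path from the root, so a cycle through a
      -- vertex can be rotated back to its parent, and finally to the root.
      obtain rfl := T.isParent_unique hF h2
      rcases Relation.ReflTransGen.cases_tail hBF with h | ⟨C, hC, hCF⟩
      · subst h
        exact ih F h2 Relation.ReflTransGen.refl
      · exact ih C hCF (Relation.ReflTransGen.head h2 hC)
  exact key F ((T.inSubtree_root_inner i).tail ⟨i, rfl, hi⟩) _ ⟨i, rfl, hi⟩ hc

theorem not_isParent_point (x : X) (E : Entry X I) : ¬ T.IsParent (Entry.point x) E := by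
  rintro ⟨i, h, -⟩
  cases h

@[simp]
theorem points_point (x : X) : T.points (Entry.point x) = {x} := by
  ext y
  constructor
  · intro h
    rcases Relation.ReflTransGen.cases_head h with h | ⟨F, hF, -⟩
    · cases h
      rfl
    · exact (T.not_isParent_point x F hF).elim
  · rintro rfl
    exact Relation.ReflTransGen.refl

theorem points_mono {E F : Entry X I} (h : T.InSubtree E F) : T.points F ⊆ T.points E :=
  fun _ hx => Relation.ReflTransGen.trans h hx

theorem points_subset_data {E : Entry X I} (h : T.IsEntry E) : T.points E ⊆ T.data :=
  T.points_mono h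

theorem exists_child_of_mem_points {i : I} {x : X} (h : x ∈ T.points (Entry.inner i)) :
    ∃ C ∈ T.children i, x ∈ T.points C := by
  rcases Relation.ReflTransGen.cases_head h with h | ⟨F, ⟨j, hj, hF⟩, hx⟩
  · cases h
  · cases hj
    exact ⟨F, hF, hx⟩

theorem mem_pointList [Finite I] {E : Entry X I} {x : X} :
    x ∈ T.pointList E ↔ x ∈ T.points E := by
  simp [pointList]

theorem Overlap.symm {E F : Entry X I} (h : T.Overlap E F) : T.Overlap F E := by
  rwa [Overlap, Set.inter_comm]

/-- Neither entry lies in the subtree of the other. -/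
def Apart (E F : Entry X I) : Prop :=
  ¬ T.InSubtree E F ∧ ¬ T.InSubtree F E

variable {T}

theorem Apart.symm {E F : Entry X I} (h : T.Apart E F) : T.Apart F E :=
  ⟨h.2, h.1⟩

theorem Apart.ne {E F : Entry X I} (h : T.Apart E F) : E ≠ F := by
  rintro rfl
  exact h.1 Relation.ReflTransGen.refl

theorem Apart.not_isParent {E F : Entry X I} (h : T.Apart E F) : ¬ T.IsParent E F :=
  fun hp => h.1 (Relation.ReflTransGen.single hp)

/-- Two ancestors of a common point would be comparable. -/
theorem Apart.not_overlap {E F : Entry X I} (h : T.Apart E F) : ¬ T.Overlap E F := by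
  rintro ⟨x, hE, hF⟩
  exact (T.inSubtree_total hE hF).elim h.1 h.2

/-- An ancestor of `C` is `C` itself or an ancestor of `F`. This preserves separation when a queue
entry is replaced by its children. -/
theorem Apart.of_isParent {E F C : Entry X I} (h : T.Apart E F) (hC : T.IsParent F C) :
    T.Apart E C := by
  refine ⟨fun h1 => ?_, fun h1 => h.2 (Relation.ReflTransGen.head hC h1)⟩
  rcases T.inSubtree_of_isParent h1 hC with rfl | h2
  · exact h.2 (Relation.ReflTransGen.single hC)
  · exact h.1 h2

theorem apart_of_siblings {E C C' : Entry X I} (h : T.IsParent E C) (h' : T.IsParent E C')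
    (hne : C ≠ C') : T.Apart C C' := by
  constructor
  · intro h1
    exact (T.inSubtree_of_isParent h1 h').elim hne (T.not_inSubtree_of_isParent h)
  · intro h1
    exact (T.inSubtree_of_isParent h1 h).elim hne.symm (T.not_inSubtree_of_isParent h')

variable (T)

theorem finite_subtree [Finite I] (E : Entry X I) : {F | T.InSubtree E F}.Finite := by
  refine ((Set.finite_singleton E).union
    (Set.finite_iUnion fun i => List.finite_toSet (T.children i))).subset ?_
  intro F hF
  rcases Relation.ReflTransGen.cases_tail hF with h1 | ⟨G, -, i, -, hi⟩
  · exact Or.inl h1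
  · exact Or.inr (Set.mem_iUnion.2 ⟨i, hi⟩)

end IndexTree

/-! ### The `k`-th entry of a sorted list. -/

/-- The total multiplicity of the listed entries whose value under `f` is at least `θ`. -/
noncomputable def weightAbove {X I : Type*} (f : Entry X I → ℝ) (θ : ℝ) (l : NNList X I) : ℕ :=
  ((l.filter (fun t => θ ≤ f t.1)).map Prod.snd).sum

/-- In a list sorted in decreasing order of `f`, the `k`-th entry has value at least `θ` exactly
if the entries of value at least `θ` have total multiplicity at least `k`. -/
theorem exists_kthEntry_iff {X I : Type*} {f : Entry X I → ℝ} {θ : ℝ} {l : NNList X I}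
    (hl : l.Pairwise (fun a b => f b.1 ≤ f a.1)) {k : ℕ} (hk : 1 ≤ k) :
    (∃ F, kthEntry k l = some F ∧ θ ≤ f F) ↔ k ≤ weightAbove f θ l := by
  induction l generalizing k with
  | nil => simp [kthEntry, weightAbove]; omega
  | cons t l ih =>
    obtain ⟨E, m⟩ := t
    rw [List.pairwise_cons] at hl
    by_cases hE : θ ≤ f E
    · have hw : weightAbove f θ ((E, m) :: l) = m + weightAbove f θ l := by
        simp [weightAbove, hE]
      rw [hw]
      by_cases hm : k ≤ m
      · simp only [kthEntry, hm, if_true]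
        exact ⟨fun _ => by omega, fun _ => ⟨E, rfl, hE⟩⟩
      · simp only [kthEntry, hm, if_false]
        -- Here `m < k`, so the truncated `k - m` is a true difference and at least `1`, as the
        -- induction requires.
        rw [ih hl.2 (by omega)]
        omega
    · have h0 : ∀ t ∈ l, ¬ θ ≤ f t.1 := fun t ht h => hE (h.trans (hl.1 t ht))
      have hw : weightAbove f θ l = 0 := by
        have : l.filter (fun t => θ ≤ f t.1) = [] := by
          simpa [List.filter_eq_nil_iff] using h0
        simp [weightAbove, this]
      have hw' : weightAbove f θ ((E, m) :: l) = 0 := by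
        rw [← hw]
        simp [weightAbove, hE]
      rw [hw']
      constructor
      · rintro ⟨F, hF, hθ⟩
        by_cases hm : k ≤ m
        · simp only [kthEntry, hm, if_true, Option.some.injEq] at hF
          exact (hE (hF ▸ hθ)).elim
        · simp only [kthEntry, hm, if_false] at hF
          have := (ih hl.2 (k := k - m) (by omega)).1 ⟨F, hF, hθ⟩
          omega
      · intro h
        omega

namespace Input

variable {X I : Type*} (P : Input X I)

/-! ### Well-formed NN-lists and counting points. -/

theorem perm_sortFor (sim : Entry X I → Entry X I → ℝ) (E : Entry X I) (l : NNList X I) :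
    (sortFor sim E l).Perm l :=
  List.perm_insertionSort _ l

theorem mem_sortFor {sim : Entry X I → Entry X I → ℝ} {E : Entry X I} {l : NNList X I}
    {t : Entry X I × ℕ} : t ∈ sortFor sim E l ↔ t ∈ l :=
  (perm_sortFor sim E l).mem_iff

theorem pairwise_sortFor (sim : Entry X I → Entry X I → ℝ) (E : Entry X I) (l : NNList X I) :
    (sortFor sim E l).Pairwise (fun a b => sim E b.1 ≤ sim E a.1) := by
  have : Std.Total (fun a b : Entry X I × ℕ => sim E b.1 ≤ sim E a.1) :=
    ⟨fun a b => le_total _ _⟩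
  have : IsTrans (Entry X I × ℕ) (fun a b => sim E b.1 ≤ sim E a.1) :=
    ⟨fun a b c h1 h2 => le_trans h2 h1⟩
  exact List.pairwise_insertionSort _ l

theorem mem_insertEntry {sim : Entry X I → Entry X I → ℝ} {E F : Entry X I} {l : NNList X I}
    {t : Entry X I × ℕ} : t ∈ P.insertEntry sim E F l ↔
      t = (F, P.multiplicity E F) ∨ t ∈ l ∧ ¬ P.tree.Overlap t.1 F := by
  simp [insertEntry, mem_sortFor]

/-- The NN-lists of `E` that occur: sorted, with pairwise disjoint entries, and such that the
multiplicity of `F` is the number of points of `F` different from any fixed point of `E`. -/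
structure WellFormed (sim : Entry X I → Entry X I → ℝ) (E : Entry X I) (l : NNList X I) :
    Prop where
  sorted : l.Pairwise (fun a b => sim E b.1 ≤ sim E a.1)
  disjoint : l.Pairwise (fun a b => ¬ P.tree.Overlap a.1 b.1)
  isEntry : ∀ t ∈ l, P.tree.IsEntry t.1
  mult : ∀ t ∈ l, ∀ e ∈ P.tree.points E, t.2 = (P.tree.points t.1 \ {e}).ncard

variable {P}

/-- Subtracting one for an overlap is correct for every `e` in `E` only if all of `E` lies in `F`.
The algorithm updates only with disjoint entries, with the entry itself, or for a single point, so
the hypothesis is always met. -/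
theorem multiplicity_eq [Finite I] {E F : Entry X I}
    (h : ¬ P.tree.Overlap E F ∨ P.tree.points E ⊆ P.tree.points F) {e : X}
    (he : e ∈ P.tree.points E) : P.multiplicity E F = (P.tree.points F \ {e}).ncard := by
  unfold multiplicity IndexTree.size
  split_ifs with ho
  · have hEF := h.resolve_left (not_not.2 ho)
    rw [Set.ncard_sdiff_singleton_of_mem (hEF he)]
  · rw [Set.sdiff_singleton_eq_self]
    exact fun hF => ho ⟨e, he, hF⟩

theorem WellFormed.nil (sim : Entry X I → Entry X I → ℝ) (E : Entry X I) :
    P.WellFormed sim E [] :=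
  ⟨List.Pairwise.nil, List.Pairwise.nil, by simp, by simp⟩

theorem WellFormed.filter {sim : Entry X I → Entry X I → ℝ} {E : Entry X I} {l : NNList X I}
    (h : P.WellFormed sim E l) (p : Entry X I × ℕ → Bool) : P.WellFormed sim E (l.filter p) :=
  ⟨h.sorted.filter p, h.disjoint.filter p, fun t ht => h.isEntry t (List.mem_of_mem_filter ht),
    fun t ht => h.mult t (List.mem_of_mem_filter ht)⟩

instance not_overlap_symm (T : IndexTree X I) :
    Std.Symm (fun a b : Entry X I × ℕ => ¬ T.Overlap a.1 b.1) :=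
  ⟨fun _ _ hab hba => hab (IndexTree.Overlap.symm T hba)⟩

/-- Inheritance by children: the multiplicities are right for each point of `E`, hence for each
point of a smaller entry. -/
theorem WellFormed.sortFor {sim : Entry X I → Entry X I → ℝ} {E C : Entry X I}
    {l : NNList X I} (h : P.WellFormed sim E l) (hC : P.tree.points C ⊆ P.tree.points E) :
    P.WellFormed sim C (sortFor sim C l) where
  sorted := pairwise_sortFor sim C l
  disjoint := h.disjoint.perm (perm_sortFor sim C l).symm (fun hab => (not_overlap_symm _).symm _ _ hab)
  isEntry t ht := h.isEntry t (mem_sortFor.1 ht)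
  mult t ht e he := h.mult t (mem_sortFor.1 ht) e (hC he)

theorem WellFormed.insertEntry [Finite I] {sim : Entry X I → Entry X I → ℝ} {E F : Entry X I}
    {l : NNList X I} (h : P.WellFormed sim E l) (hF : P.tree.IsEntry F)
    (hEF : ¬ P.tree.Overlap E F ∨ P.tree.points E ⊆ P.tree.points F) :
    P.WellFormed sim E (P.insertEntry sim E F l) where
  sorted := pairwise_sortFor sim E _
  disjoint := by
    refine List.Pairwise.perm ?_ (perm_sortFor sim E _).symm
      (fun hab => (not_overlap_symm _).symm _ _ hab)
    rw [List.pairwise_cons]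
    refine ⟨fun t ht ho => ?_, h.disjoint.filter _⟩
    have hto : t ∈ l ∧ ¬ P.tree.Overlap t.1 F := by simpa using ht
    exact hto.2 (IndexTree.Overlap.symm _ ho)
  isEntry t ht := by
    rcases P.mem_insertEntry.1 ht with rfl | ⟨ht, -⟩
    · exact hF
    · exact h.isEntry t ht
  mult t ht e he := by
    rcases P.mem_insertEntry.1 ht with rfl | ⟨ht, -⟩
    · exact multiplicity_eq hEF he
    · exact h.mult t ht e he

theorem WellFormed.eq_of_overlap {sim : Entry X I → Entry X I → ℝ} {E : Entry X I}
    {l : NNList X I} (h : P.WellFormed sim E l) {t u : Entry X I × ℕ} (ht : t ∈ l) (hu : u ∈ l)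
    (ho : P.tree.Overlap t.1 u.1) : t = u := by
  by_contra hne
  exact h.disjoint.forall ht hu hne ho

/-- The points other than `e` in the listed entries of value at least `θ`. -/
def pointsAbove (P : Input X I) (sim : Entry X I → Entry X I → ℝ) (E : Entry X I) (θ : ℝ)
    (l : NNList X I) (e : X) : Set X :=
  {y | y ≠ e ∧ ∃ t ∈ l, θ ≤ sim E t.1 ∧ y ∈ P.tree.points t.1}

theorem sum_multiplicities [Finite I] {e : X} {l : NNList X I}
    (hd : l.Pairwise (fun a b => ¬ P.tree.Overlap a.1 b.1))
    (hm : ∀ t ∈ l, t.2 = (P.tree.points t.1 \ {e}).ncard) :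
    {y | y ≠ e ∧ ∃ t ∈ l, y ∈ P.tree.points t.1}.Finite ∧
      {y | y ≠ e ∧ ∃ t ∈ l, y ∈ P.tree.points t.1}.ncard = (l.map Prod.snd).sum := by
  induction l with
  | nil => simp
  | cons t l ih =>
    rw [List.pairwise_cons] at hd
    obtain ⟨hf, hc⟩ := ih hd.2 (fun u hu => hm u (List.mem_cons_of_mem _ hu))
    have hs : {y | y ≠ e ∧ ∃ u ∈ t :: l, y ∈ P.tree.points u.1} =
        (P.tree.points t.1 \ {e}) ∪ {y | y ≠ e ∧ ∃ u ∈ l, y ∈ P.tree.points u.1} := by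
      ext y
      simp only [List.mem_cons, exists_eq_or_imp, Set.mem_ofPred_eq, Set.mem_union, Set.mem_sdiff,
        Set.mem_singleton_iff]
      tauto
    have hft : (P.tree.points t.1 \ {e}).Finite := (P.tree.finite_points t.1).sdiff
    have hdis : Disjoint (P.tree.points t.1 \ {e})
        {y | y ≠ e ∧ ∃ u ∈ l, y ∈ P.tree.points u.1} := by
      rw [Set.disjoint_left]
      rintro y ⟨hy, -⟩ ⟨-, u, hu, hyu⟩
      exact hd.1 u hu ⟨y, hy, hyu⟩
    rw [hs]
    refine ⟨hft.union hf, ?_⟩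
    rw [Set.ncard_union_eq hdis hft hf, hc, List.map_cons, List.sum_cons,
      hm t (List.mem_cons_self)]

theorem WellFormed.ncard_pointsAbove [Finite I] {sim : Entry X I → Entry X I → ℝ}
    {E : Entry X I} {l : NNList X I} (h : P.WellFormed sim E l) (θ : ℝ) {e : X}
    (he : e ∈ P.tree.points E) :
    (P.pointsAbove sim E θ l e).Finite ∧
      (P.pointsAbove sim E θ l e).ncard = weightAbove (sim E) θ l := by
  have hs : P.pointsAbove sim E θ l e = {y | y ≠ e ∧
      ∃ t ∈ l.filter (fun t => θ ≤ sim E t.1), y ∈ P.tree.points t.1} := by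
    ext y
    simp [pointsAbove, and_assoc]
  rw [hs]
  exact sum_multiplicities (h.filter _).disjoint fun t ht => (h.filter _).mult t ht e he

/-- The bridge from lists to counting. The left side does not mention `e`, so one test decides for
all points of `E` at once. -/
theorem WellFormed.exists_kthEntry_iff [Finite I] {sim : Entry X I → Entry X I → ℝ}
    {E : Entry X I} {l : NNList X I} (h : P.WellFormed sim E l) (hk : 1 ≤ P.k) (θ : ℝ) {e : X}
    (he : e ∈ P.tree.points E) :
    (∃ F, kthEntry P.k l = some F ∧ θ ≤ sim E F) ↔
      P.k ≤ (P.pointsAbove sim E θ l e).ncard := by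
  rw [(h.ncard_pointsAbove θ he).2]
  exact RkNN.exists_kthEntry_iff h.sorted hk

/-! ### Soundness of hits and drops. -/

/-- The reverse `k`-nearest-neighbour set that the algorithm is to find. -/
abbrev answer (P : Input X I) (Sim : X → X → ℝ) : Set X :=
  reverseKNN Sim P.tree.data P.k P.query

/-- A competitor `y` of `Q` lies in some listed entry `t` by `hcov`, and there `MinSim(E,Q) ≤
Sim(e,Q) ≤ Sim(e,y) ≤ MaxSim(E,t)`. So all competitors are counted, and a hit counts fewer than `k`.
-/
theorem IsHit.mem_answer [Finite I] {Sim : X → X → ℝ} (hk : 1 ≤ P.k)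
    (hv : P.ValidBounds Sim) {s : State X I} {E : Entry X I} (hit : P.IsHit s E)
    (hE : P.tree.IsEntry E) (hw : P.WellFormed P.maxSim E (s.NNU E)) {e : X}
    (he : e ∈ P.tree.points E)
    (hcov : ∀ y ∈ P.tree.data, y ≠ e → ∃ t ∈ s.NNU E, y ∈ P.tree.points t.1) :
    e ∈ P.answer Sim := by
  have hlt : (P.pointsAbove P.maxSim E (P.minSim E (Entry.point P.query)) (s.NNU E) e).ncard
      < P.k := by
    by_contra hge
    obtain ⟨F, hF, hle⟩ := (hw.exists_kthEntry_iff hk _ he).2 (not_lt.1 hge)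
    exact absurd (hit F hF) (not_lt.2 hle)
  refine ⟨P.tree.points_subset_data hE he, lt_of_le_of_lt (Set.ncard_le_ncard ?_
    (hw.ncard_pointsAbove _ he).1) hlt⟩
  rintro y ⟨hyD, hye, hy⟩
  obtain ⟨t, ht, hyt⟩ := hcov y hyD hye
  refine ⟨hye, t, ht, ?_, hyt⟩
  have h1 := (hv E _ hE (Or.inr rfl) e he P.query (by simp)).1
  have h2 := (hv E t.1 hE (Or.inl (hw.isEntry t ht)) e he y hyt).2
  linarith

/-- Each point counted above `MaxSim(E,Q)` in the lower list is a competitor, so an incomplete list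
does no harm. -/
theorem IsDrop.notMem_answer [Finite I] {Sim : X → X → ℝ} (hk : 1 ≤ P.k)
    (hv : P.ValidBounds Sim) {s : State X I} {E : Entry X I} (drop : P.IsDrop s E)
    (hE : P.tree.IsEntry E) (hw : P.WellFormed P.minSim E (s.NNL E)) {e : X}
    (he : e ∈ P.tree.points E) : e ∉ P.answer Sim := by
  rintro ⟨-, hlt⟩
  have hge := (hw.exists_kthEntry_iff hk _ he).1 drop
  refine absurd (hge.trans (Set.ncard_le_ncard ?_ ?_)) (not_le.2 hlt)
  · rintro y ⟨hye, t, ht, hθ, hyt⟩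
    refine ⟨P.tree.points_subset_data (hw.isEntry t ht) hyt, hye, ?_⟩
    have h1 := (hv E _ hE (Or.inr rfl) e he P.query (by simp)).2
    have h2 := (hv E t.1 hE (Or.inl (hw.isEntry t ht)) e he y hyt).1
    linarith
  · exact (P.tree.finite_points P.tree.root).subset fun y hy => hy.1

/-! ### Effect of the elementary operations on the lists. -/

/-- All NN-lists of the state are well-formed. -/
def WellFormedLists (P : Input X I) (s : State X I) : Prop :=
  ∀ A, P.WellFormed P.minSim A (s.NNL A) ∧ P.WellFormed P.maxSim A (s.NNU A)

/-- The two states differ at most in their NN-lists. -/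
structure SameQueues (s s' : State X I) : Prop where
  U : s'.U = s.U
  COL : s'.COL = s.COL
  ROL : s'.ROL = s.ROL
  PEL : s'.PEL = s.PEL

theorem SameQueues.refl (s : State X I) : SameQueues s s :=
  ⟨rfl, rfl, rfl, rfl⟩

theorem SameQueues.trans {s s' s'' : State X I} (h : SameQueues s s') (h' : SameQueues s' s'') :
    SameQueues s s'' :=
  ⟨h'.U.trans h.U, h'.COL.trans h.COL, h'.ROL.trans h.ROL, h'.PEL.trans h.PEL⟩

theorem sameQueues_update (E F : Entry X I) (s : State X I) : SameQueues s (P.update E F s) :=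
  ⟨rfl, rfl, rfl, rfl⟩

theorem NNL_update_self (E F : Entry X I) (s : State X I) :
    (P.update E F s).NNL E = P.insertEntry P.minSim E F (s.NNL E) := by
  simp [update]

theorem NNU_update_self (E F : Entry X I) (s : State X I) :
    (P.update E F s).NNU E = P.insertEntry P.maxSim E F (s.NNU E) := by
  simp [update]

theorem NNL_update_of_ne {A E : Entry X I} (h : A ≠ E) (F : Entry X I) (s : State X I) :
    (P.update E F s).NNL A = s.NNL A := by
  simp [update, h]

theorem NNU_update_of_ne {A E : Entry X I} (h : A ≠ E) (F : Entry X I) (s : State X I) :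
    (P.update E F s).NNU A = s.NNU A := by
  simp [update, h]

theorem WellFormedLists.update [Finite I] {s : State X I} (h : P.WellFormedLists s)
    {E F : Entry X I} (hF : P.tree.IsEntry F)
    (hEF : ¬ P.tree.Overlap E F ∨ P.tree.points E ⊆ P.tree.points F) :
    P.WellFormedLists (P.update E F s) := by
  intro A
  by_cases hA : A = E
  · subst hA
    rw [NNL_update_self, NNU_update_self]
    exact ⟨(h A).1.insertEntry hF hEF, (h A).2.insertEntry hF hEF⟩
  · rw [NNL_update_of_ne hA, NNU_update_of_ne hA]
    exact h A

theorem mem_NNU_update {s : State X I} {A E F : Entry X I} {t : Entry X I × ℕ}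
    (ht : t ∈ s.NNU A) (hF : A = E → ¬ P.tree.Overlap t.1 F) :
    t ∈ (P.update E F s).NNU A := by
  by_cases hA : A = E
  · subst hA
    rw [NNU_update_self]
    exact P.mem_insertEntry.2 (Or.inr ⟨ht, hF rfl⟩)
  · rwa [NNU_update_of_ne hA]

theorem mem_NNL_update {s : State X I} {A E F : Entry X I} {t : Entry X I × ℕ}
    (ht : t ∈ s.NNL A) (hF : A = E → ¬ P.tree.Overlap t.1 F) :
    t ∈ (P.update E F s).NNL A := by
  by_cases hA : A = E
  · subst hA
    rw [NNL_update_self]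
    exact P.mem_insertEntry.2 (Or.inr ⟨ht, hF rfl⟩)
  · rwa [NNL_update_of_ne hA]

theorem exists_mem_NNU_update_self (E F : Entry X I) (s : State X I) :
    ∃ m, (F, m) ∈ (P.update E F s).NNU E := by
  rw [NNU_update_self]
  exact ⟨_, P.mem_insertEntry.2 (Or.inl rfl)⟩

theorem exists_mem_NNL_update_self (E F : Entry X I) (s : State X I) :
    ∃ m, (F, m) ∈ (P.update E F s).NNL E := by
  rw [NNL_update_self]
  exact ⟨_, P.mem_insertEntry.2 (Or.inl rfl)⟩

theorem sameQueues_removeParent (E : Entry X I) (s : State X I) :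
    SameQueues s (P.removeParent E s) :=
  ⟨rfl, rfl, rfl, rfl⟩

theorem WellFormedLists.removeParent {s : State X I} (h : P.WellFormedLists s)
    (E : Entry X I) : P.WellFormedLists (P.removeParent E s) := by
  classical
  intro A
  by_cases hA : A = E
  · subst hA
    simp only [Input.removeParent, Function.update_self]
    exact ⟨(h A).1.filter _, (h A).2.filter _⟩
  · simp only [Input.removeParent, Function.update_of_ne hA]
    exact h A

theorem mem_NNU_removeParent {s : State X I} {A E : Entry X I} {t : Entry X I × ℕ}
    (ht : t ∈ s.NNU A) (h : P.tree.Apart t.1 E) : t ∈ (P.removeParent E s).NNU A := by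
  classical
  by_cases hA : A = E
  · subst hA
    simp only [removeParent, Function.update_self]
    exact List.mem_filter.2 ⟨ht, by simp [h.ne, h.not_isParent]⟩
  · simpa only [removeParent, Function.update_of_ne hA] using ht

theorem sameQueues_addSelf (E : Entry X I) (s : State X I) : SameQueues s (P.addSelf E s) := by
  cases E
  · exact SameQueues.refl s
  · exact sameQueues_update _ _ s

theorem WellFormedLists.addSelf [Finite I] {s : State X I} (h : P.WellFormedLists s)
    {E : Entry X I} (hE : P.tree.IsEntry E) : P.WellFormedLists (P.addSelf E s) := by
  cases E
  · exact h
  · exact h.update hE (Or.inr subset_rfl)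

theorem mem_NNU_addSelf {s : State X I} {A E : Entry X I} {t : Entry X I × ℕ}
    (ht : t ∈ s.NNU A) (h : P.tree.Apart t.1 E) : t ∈ (P.addSelf E s).NNU A := by
  cases E
  · exact ht
  · exact mem_NNU_update ht fun _ => h.not_overlap

theorem exists_mem_NNU_addSelf (i : I) (s : State X I) :
    ∃ m, (Entry.inner i, m) ∈ (P.addSelf (Entry.inner i) s).NNU (Entry.inner i) :=
  exists_mem_NNU_update_self _ _ s

/-- `E` and the entries of `L` update their NN-lists with each other. -/
noncomputable def mutualUpdate (P : Input X I) (E : Entry X I) (L : List (Entry X I))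
    (s : State X I) : State X I :=
  L.foldl (fun s F => P.update F E (P.update E F s)) s

theorem sameQueues_mutualUpdate (E : Entry X I) (L : List (Entry X I)) (s : State X I) :
    SameQueues s (P.mutualUpdate E L s) := by
  induction L generalizing s with
  | nil => exact SameQueues.refl s
  | cons B L ih =>
    exact ((sameQueues_update E B s).trans (sameQueues_update B E _)).trans (ih _)

theorem WellFormedLists.mutualUpdate [Finite I] {s : State X I} (h : P.WellFormedLists s)
    {E : Entry X I} {L : List (Entry X I)} (hE : P.tree.IsEntry E)
    (hL : ∀ B ∈ L, P.tree.IsEntry B ∧ P.tree.Apart E B) :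
    P.WellFormedLists (P.mutualUpdate E L s) := by
  induction L generalizing s with
  | nil => exact h
  | cons B L ih =>
    obtain ⟨hB, hEB⟩ := hL B List.mem_cons_self
    exact ih ((h.update hB (Or.inl hEB.not_overlap)).update hE (Or.inl hEB.symm.not_overlap))
      fun C hC => hL C (List.mem_cons_of_mem _ hC)

/-- Only an overlapping insertion evicts: the lists of `E` receive the entries of `L`, those of the
entries of `L` receive `E`. -/
theorem mem_NNU_mutualUpdate {s : State X I} {A E : Entry X I} {L : List (Entry X I)}
    {t : Entry X I × ℕ} (ht : t ∈ s.NNU A)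
    (h1 : A = E → ∀ B ∈ L, ¬ P.tree.Overlap t.1 B) (h2 : A ∈ L → ¬ P.tree.Overlap t.1 E) :
    t ∈ (P.mutualUpdate E L s).NNU A := by
  induction L generalizing s with
  | nil => exact ht
  | cons B L ih =>
    refine ih (mem_NNU_update (mem_NNU_update ht fun hA => h1 hA B List.mem_cons_self) ?_)
      (fun hA C hC => h1 hA C (List.mem_cons_of_mem _ hC))
      (fun hA => h2 (List.mem_cons_of_mem _ hA))
    rintro rfl
    exact h2 List.mem_cons_self

theorem exists_mem_NNU_mutualUpdate_left {s : State X I} {E : Entry X I}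
    {L : List (Entry X I)} (hL : L.Pairwise P.tree.Apart) (hE : ∀ B ∈ L, P.tree.Apart E B)
    {B : Entry X I} (hB : B ∈ L) : ∃ m, (B, m) ∈ (P.mutualUpdate E L s).NNU E := by
  induction L generalizing s with
  | nil => cases hB
  | cons C L ih =>
    rw [List.pairwise_cons] at hL
    change ∃ m, _ ∈ (P.mutualUpdate E L (P.update C E (P.update E C s))).NNU E
    have hE' : ∀ B ∈ L, P.tree.Apart E B := fun B hB => hE B (List.mem_cons_of_mem _ hB)
    rcases List.mem_cons.1 hB with rfl | hB
    · obtain ⟨m, hm⟩ := exists_mem_NNU_update_self (P := P) E B s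
      refine ⟨m, mem_NNU_mutualUpdate (mem_NNU_update hm fun h => ?_)
        (fun _ C hC => (hL.1 C hC).not_overlap) fun h => ?_⟩
      · exact ((hE B List.mem_cons_self).ne h).elim
      · exact ((hE' E h).ne rfl).elim
    · exact ih hL.2 hE' hB

theorem exists_mem_NNU_mutualUpdate_right {s : State X I} {E : Entry X I}
    {L : List (Entry X I)} (hL : L.Pairwise P.tree.Apart) (hE : ∀ B ∈ L, P.tree.Apart E B)
    {B : Entry X I} (hB : B ∈ L) : ∃ m, (E, m) ∈ (P.mutualUpdate E L s).NNU B := by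
  induction L generalizing s with
  | nil => cases hB
  | cons C L ih =>
    rw [List.pairwise_cons] at hL
    change ∃ m, _ ∈ (P.mutualUpdate E L (P.update C E (P.update E C s))).NNU B
    rcases List.mem_cons.1 hB with rfl | hB
    · obtain ⟨m, hm⟩ := exists_mem_NNU_update_self (P := P) B E (P.update E B s)
      refine ⟨m, mem_NNU_mutualUpdate hm (fun h => ?_) fun h => ?_⟩
      · exact ((hE B List.mem_cons_self).ne h.symm).elim
      · exact ((hL.1 B h).ne rfl).elim
    · exact ih hL.2 (fun B hB => hE B (List.mem_cons_of_mem _ hB)) hB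

/-- The entries of `L` are enqueued and inherit the NN-lists of `E`. -/
noncomputable def enqueueAll (P : Input X I) (E : Entry X I) (L : List (Entry X I))
    (s : State X I) : State X I :=
  L.foldl (fun s C => P.enqueueChild E C s) s

theorem U_enqueueAll (E : Entry X I) (L : List (Entry X I)) (s : State X I) :
    (P.enqueueAll E L s).U = s.U ++ L := by
  induction L generalizing s with
  | nil => simp [enqueueAll]
  | cons C L ih =>
    have := ih (P.enqueueChild E C s)
    simpa [enqueueAll, enqueueChild] using this

theorem queues_enqueueAll (E : Entry X I) (L : List (Entry X I)) (s : State X I) :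
    (P.enqueueAll E L s).COL = s.COL ∧ (P.enqueueAll E L s).ROL = s.ROL ∧
      (P.enqueueAll E L s).PEL = s.PEL := by
  induction L generalizing s with
  | nil => exact ⟨rfl, rfl, rfl⟩
  | cons C L ih => exact ih (P.enqueueChild E C s)

theorem WellFormedLists.enqueueAll {s : State X I} (h : P.WellFormedLists s) {E : Entry X I}
    {L : List (Entry X I)} (hL : ∀ C ∈ L, P.tree.points C ⊆ P.tree.points E) :
    P.WellFormedLists (P.enqueueAll E L s) := by
  classical
  induction L generalizing s with
  | nil => exact h
  | cons C L ih =>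
    refine ih (fun A => ?_) fun D hD => hL D (List.mem_cons_of_mem _ hD)
    by_cases hA : A = C
    · subst hA
      simp only [enqueueChild, Function.update_self]
      exact ⟨(h E).1.sortFor (hL A List.mem_cons_self), (h E).2.sortFor (hL A List.mem_cons_self)⟩
    · simp only [enqueueChild, Function.update_of_ne hA]
      exact h A

/-- As `E ∉ L`, the lists of `E` are not overwritten while they are being copied. -/
theorem mem_NNU_enqueueAll {s : State X I} {A E : Entry X I} {L : List (Entry X I)}
    (hE : E ∉ L) {t : Entry X I × ℕ} :
    t ∈ (P.enqueueAll E L s).NNU A ↔ A ∈ L ∧ t ∈ s.NNU E ∨ A ∉ L ∧ t ∈ s.NNU A := by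
  classical
  induction L generalizing s with
  | nil => simp [enqueueAll]
  | cons C L ih =>
    have hEC : E ≠ C := fun h => hE (h ▸ List.mem_cons_self)
    have key := ih (s := P.enqueueChild E C s) fun h => hE (List.mem_cons_of_mem _ h)
    have h1 : (P.enqueueChild E C s).NNU E = s.NNU E := by
      simp [enqueueChild, hEC]
    change t ∈ (P.enqueueAll E L (P.enqueueChild E C s)).NNU A ↔ _
    rw [key, h1]
    by_cases hA : A = C
    · subst hA
      have h2 : t ∈ (P.enqueueChild E A s).NNU A ↔ t ∈ s.NNU E := by
        simp [enqueueChild, mem_sortFor]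
      rw [h2]
      simp only [List.mem_cons, true_or, true_and, not_true, false_and, or_false]
      tauto
    · have h2 : (P.enqueueChild E C s).NNU A = s.NNU A := by
        simp [enqueueChild, hA]
      rw [h2]
      simp only [List.mem_cons, hA, false_or]

/-! ### The invariant of the main loop. -/

/-- The point `y` lies in a candidate, a result or a pruned entry. -/
def Settled (P : Input X I) (s : State X I) (y : X) : Prop :=
  y ∈ s.COL ∨ y ∈ s.ROL ∨ ∃ F ∈ s.PEL, y ∈ P.tree.points F

/-- The upper NN-lists of the entries of `L` contain the point `y`, in an entry that is disjoint
from all entries of `L'`. -/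
def Covers (P : Input X I) (s : State X I) (L L' : List (Entry X I)) (y : X) : Prop :=
  ∀ A ∈ L, ∃ t ∈ s.NNU A, y ∈ P.tree.points t.1 ∧ ∀ B ∈ L', P.tree.Apart t.1 B

/-- The invariant of the main loop. -/
structure MainInvariant (P : Input X I) (Sim : X → X → ℝ) (s : State X I) : Prop where
  lists : P.WellFormedLists s
  isEntry : ∀ A ∈ s.U, P.tree.IsEntry A
  apart : s.U.Pairwise P.tree.Apart
  cover : ∀ y ∈ P.tree.data,
    (∃ B ∈ s.U, y ∈ P.tree.points B) ∨ P.Settled s y ∧ P.Covers s s.U s.U y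
  col : ∀ y ∈ s.COL, y ∈ P.tree.data
  rol : ∀ y ∈ s.ROL, y ∈ P.answer Sim
  pel : ∀ F ∈ s.PEL, P.tree.IsEntry F ∧ ∀ y ∈ P.tree.points F, y ∉ P.answer Sim

theorem mainInvariant_initialState (Sim : X → X → ℝ) :
    P.MainInvariant Sim P.initialState where
  lists A := ⟨WellFormed.nil _ _, WellFormed.nil _ _⟩
  isEntry A hA := by
    rw [List.mem_singleton.1 hA]
    exact Relation.ReflTransGen.refl
  apart := List.pairwise_singleton _ _
  cover y hy := Or.inl ⟨_, List.mem_singleton.2 rfl, hy⟩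
  col y hy := by simp [initialState] at hy
  rol y hy := by simp [initialState] at hy
  pel F hF := by simp [initialState] at hF

/-- The state in which a dequeued entry is tested. -/
noncomputable def beforeTest (P : Input X I) (E : Entry X I) (rest : List (Entry X I))
    (s : State X I) : State X I :=
  P.mutualEffect E (P.addSelf E (P.removeParent E { s with U := rest }))

theorem beforeTest_eq (E : Entry X I) (rest : List (Entry X I)) (s : State X I) :
    P.beforeTest E rest s =
      P.mutualUpdate E rest (P.addSelf E (P.removeParent E { s with U := rest })) := by
  unfold beforeTest mutualEffect mutualUpdate
  rw [(sameQueues_addSelf E _).U, (sameQueues_removeParent E _).U]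

theorem sameQueues_beforeTest (E : Entry X I) (rest : List (Entry X I)) (s : State X I) :
    SameQueues { s with U := rest } (P.beforeTest E rest s) := by
  rw [beforeTest_eq]
  exact ((sameQueues_removeParent E _).trans (sameQueues_addSelf E _)).trans
    (sameQueues_mutualUpdate E rest _)

/-- What holds when the dequeued entry `E` is tested in the state `s`. -/
structure TestInvariant (P : Input X I) (Sim : X → X → ℝ) (E : Entry X I) (s : State X I) :
    Prop where
  lists : P.WellFormedLists s
  isEntry : ∀ A ∈ s.U, P.tree.IsEntry A
  isEntry_self : P.tree.IsEntry E
  apart : s.U.Pairwise P.tree.Apart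
  apart_self : ∀ A ∈ s.U, P.tree.Apart E A
  cover : ∀ y ∈ P.tree.data, y ∈ P.tree.points E ∨ (∃ B ∈ s.U, y ∈ P.tree.points B) ∨
    P.Settled s y ∧ P.Covers s (E :: s.U) (E :: s.U) y
  left : ∀ A ∈ s.U, ∃ m, (A, m) ∈ s.NNU E
  right : ∀ A ∈ s.U, ∃ m, (E, m) ∈ s.NNU A
  self : ∀ i, E = Entry.inner i → ∃ m, (E, m) ∈ s.NNU E
  col : ∀ y ∈ s.COL, y ∈ P.tree.data
  rol : ∀ y ∈ s.ROL, y ∈ P.answer Sim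
  pel : ∀ F ∈ s.PEL, P.tree.IsEntry F ∧ ∀ y ∈ P.tree.points F, y ∉ P.answer Sim

/-- Entries that cover settled points are apart from `E` and from the rest of the queue. Hence they
are neither `E` nor its parent, and no insertion overlaps them: they survive all three preparatory
steps. -/
theorem MainInvariant.beforeTest [Finite I] {Sim : X → X → ℝ} {s : State X I}
    (h : P.MainInvariant Sim s) {E : Entry X I} {rest : List (Entry X I)}
    (hU : s.U = E :: rest) : P.TestInvariant Sim E (P.beforeTest E rest s) := by
  obtain ⟨qU, qC, qR, qP⟩ := sameQueues_beforeTest (P := P) E rest s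
  have hap := h.apart
  rw [hU, List.pairwise_cons] at hap
  have hE : P.tree.IsEntry E := h.isEntry E (hU ▸ List.mem_cons_self)
  have hrest : ∀ A ∈ rest, P.tree.IsEntry A :=
    fun A hA => h.isEntry A (hU ▸ List.mem_cons_of_mem _ hA)
  simp only at qU qC qR qP
  refine ⟨?_, by rwa [qU], hE, by rw [qU]; exact hap.2, by rw [qU]; exact hap.1, ?_, ?_, ?_, ?_,
    by rw [qC]; exact h.col, by rw [qR]; exact h.rol, by rw [qP]; exact h.pel⟩
  · rw [beforeTest_eq]
    refine WellFormedLists.mutualUpdate (WellFormedLists.addSelf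
      (WellFormedLists.removeParent ?_ E) hE) hE fun B hB => ⟨hrest B hB, hap.1 B hB⟩
    exact h.lists
  · intro y hy
    rcases h.cover y hy with ⟨B, hB, hyB⟩ | ⟨hs, hc⟩
    · rw [hU] at hB
      rcases List.mem_cons.1 hB with rfl | hB
      · exact Or.inl hyB
      · exact Or.inr (Or.inl ⟨B, by rwa [qU], hyB⟩)
    · refine Or.inr (Or.inr ⟨?_, ?_⟩)
      · rwa [Settled, qC, qR, qP]
      · rw [qU]
        rw [hU] at hc
        intro A hA
        obtain ⟨t, ht, hyt, hB⟩ := hc A hA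
        have htE := hB E List.mem_cons_self
        refine ⟨t, ?_, hyt, hB⟩
        rw [beforeTest_eq]
        refine mem_NNU_mutualUpdate (mem_NNU_addSelf (mem_NNU_removeParent ?_ htE) htE)
          (fun _ B hB' => (hB B (List.mem_cons_of_mem _ hB')).not_overlap)
          fun _ => htE.not_overlap
        exact ht
  · rw [qU, beforeTest_eq]
    exact fun A hA => exists_mem_NNU_mutualUpdate_left hap.2 hap.1 hA
  · rw [qU, beforeTest_eq]
    exact fun A hA => exists_mem_NNU_mutualUpdate_right hap.2 hap.1 hA
  · rintro i rfl
    rw [beforeTest_eq]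
    obtain ⟨m, hm⟩ := exists_mem_NNU_addSelf (P := P) i
      (P.removeParent (Entry.inner i) { s with U := rest })
    exact ⟨m, mem_NNU_mutualUpdate hm (fun _ B hB => (hap.1 B hB).not_overlap)
      fun hi => ((hap.1 _ hi).ne rfl).elim⟩

/-- Coverage for the hit test has three sources: `E` in its own list, the queue entries just
inserted, and the surviving entries for settled points. A single point needs no entry for itself,
since `y ≠ e`. -/
theorem TestInvariant.exists_mem_NNU {Sim : X → X → ℝ} {s : State X I} {E : Entry X I}
    (h : P.TestInvariant Sim E s) {e : X} (he : e ∈ P.tree.points E) :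
    ∀ y ∈ P.tree.data, y ≠ e → ∃ t ∈ s.NNU E, y ∈ P.tree.points t.1 := by
  intro y hy hye
  rcases h.cover y hy with hyE | ⟨B, hB, hyB⟩ | ⟨-, hc⟩
  · cases E with
    | point x =>
      rw [IndexTree.points_point, Set.mem_singleton_iff] at hyE he
      exact (hye (hyE.trans he.symm)).elim
    | inner i =>
      obtain ⟨m, hm⟩ := h.self i rfl
      exact ⟨_, hm, hyE⟩
  · obtain ⟨m, hm⟩ := h.left B hB
    exact ⟨_, hm, hyB⟩
  · obtain ⟨t, ht, hyt, -⟩ := hc E List.mem_cons_self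
    exact ⟨t, ht, hyt⟩

/-- If a tested entry is not replaced by its children, its points are settled. -/
theorem TestInvariant.settle {Sim : X → X → ℝ} {s s' : State X I} {E : Entry X I}
    (h : P.TestInvariant Sim E s) (hU : s'.U = s.U) (hL : s'.NNL = s.NNL) (hN : s'.NNU = s.NNU)
    (hs : ∀ y, P.Settled s y → P.Settled s' y)
    (hE : ∀ y ∈ P.tree.points E, P.Settled s' y)
    (col : ∀ y ∈ s'.COL, y ∈ P.tree.data) (rol : ∀ y ∈ s'.ROL, y ∈ P.answer Sim)
    (pel : ∀ F ∈ s'.PEL, P.tree.IsEntry F ∧ ∀ y ∈ P.tree.points F, y ∉ P.answer Sim) :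
    P.MainInvariant Sim s' where
  lists A := by rw [hL, hN]; exact h.lists A
  isEntry := by rw [hU]; exact h.isEntry
  apart := by rw [hU]; exact h.apart
  cover y hy := by
    rw [Covers, hU, hN]
    rcases h.cover y hy with hyE | hB | ⟨hc, hc'⟩
    · refine Or.inr ⟨hE y hyE, fun A hA => ?_⟩
      -- The newly settled points of `E` are covered by `E` itself, which the mutual update has put
      -- into the list of every remaining queue entry.
      obtain ⟨m, hm⟩ := h.right A hA
      exact ⟨_, hm, hyE, h.apart_self⟩
    · exact Or.inl hB
    · refine Or.inr ⟨hs y hc, fun A hA => ?_⟩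
      obtain ⟨t, ht, hyt, hB⟩ := hc' A (List.mem_cons_of_mem _ hA)
      exact ⟨t, ht, hyt, fun B hB' => hB B (List.mem_cons_of_mem _ hB')⟩
  col := col
  rol := rol
  pel := pel

/-- The points of the node pass to its children in the queue. Covering entries are apart from the
node, hence from its children, which inherit them. -/
theorem TestInvariant.enqueueAll {Sim : X → X → ℝ} {s : State X I} {i : I}
    (h : P.TestInvariant Sim (Entry.inner i) s) :
    P.MainInvariant Sim (P.enqueueAll (Entry.inner i) (P.tree.children i) s) := by
  have hpar : ∀ C ∈ P.tree.children i, P.tree.IsParent (Entry.inner i) C :=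
    fun C hC => ⟨i, rfl, hC⟩
  have hself : Entry.inner i ∉ P.tree.children i := fun hi =>
    P.tree.not_inSubtree_of_isParent (hpar _ hi) Relation.ReflTransGen.refl
  have hUC : ∀ A ∈ s.U, ∀ C ∈ P.tree.children i, P.tree.Apart A C := fun A hA C hC =>
    (h.apart_self A hA).symm.of_isParent (hpar C hC)
  obtain ⟨qC, qR, qP⟩ := queues_enqueueAll (P := P) (Entry.inner i) (P.tree.children i) s
  refine ⟨?_, ?_, ?_, ?_, by rw [qC]; exact h.col, by rw [qR]; exact h.rol,
    by rw [qP]; exact h.pel⟩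
  · exact h.lists.enqueueAll fun C hC =>
      P.tree.points_mono (Relation.ReflTransGen.single (hpar C hC))
  · rw [U_enqueueAll]
    intro A hA
    rcases List.mem_append.1 hA with hA | hA
    · exact h.isEntry A hA
    · exact Relation.ReflTransGen.tail h.isEntry_self (hpar A hA)
  · rw [U_enqueueAll, List.pairwise_append]
    refine ⟨h.apart, ?_, hUC⟩
    exact (P.tree.children_nodup i).imp_of_mem fun hA hB hne =>
      IndexTree.apart_of_siblings (hpar _ hA) (hpar _ hB) hne
  · intro y hy
    rw [U_enqueueAll]
    rcases h.cover y hy with hyE | ⟨B, hB, hyB⟩ | ⟨hs, hc⟩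
    · obtain ⟨C, hC, hyC⟩ := P.tree.exists_child_of_mem_points hyE
      exact Or.inl ⟨C, List.mem_append_right _ hC, hyC⟩
    · exact Or.inl ⟨B, List.mem_append_left _ hB, hyB⟩
    · refine Or.inr ⟨by rwa [Settled, qC, qR, qP], fun A hA => ?_⟩
      have key : ∀ t : Entry X I × ℕ, (∀ B ∈ Entry.inner i :: s.U, P.tree.Apart t.1 B) →
          ∀ B ∈ s.U ++ P.tree.children i, P.tree.Apart t.1 B := by
        intro t ht B hB
        rcases List.mem_append.1 hB with hB | hB
        · exact ht B (List.mem_cons_of_mem _ hB)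
        · exact (ht _ List.mem_cons_self).of_isParent (hpar B hB)
      by_cases hAC : A ∈ P.tree.children i
      · obtain ⟨t, ht, hyt, hB⟩ := hc _ List.mem_cons_self
        exact ⟨t, (mem_NNU_enqueueAll hself).2 (Or.inl ⟨hAC, ht⟩), hyt, key t hB⟩
      · have hAU : A ∈ s.U := (List.mem_append.1 hA).resolve_right hAC
        obtain ⟨t, ht, hyt, hB⟩ := hc A (List.mem_cons_of_mem _ hAU)
        exact ⟨t, (mem_NNU_enqueueAll hself).2 (Or.inr ⟨hAC, ht⟩), hyt, key t hB⟩

theorem TestInvariant.testEntry [Finite I] {Sim : X → X → ℝ} (hk : 1 ≤ P.k)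
    (hv : P.ValidBounds Sim) {s : State X I} {E : Entry X I} (h : P.TestInvariant Sim E s) :
    P.MainInvariant Sim (P.testEntry E s) := by
  unfold Input.testEntry
  split_ifs with hit drop
  · refine h.settle rfl rfl rfl ?_ ?_ h.col ?_ h.pel
    · rintro y (hy | hy | hy)
      · exact Or.inl hy
      · exact Or.inr (Or.inl (List.mem_append_left _ hy))
      · exact Or.inr (Or.inr hy)
    · exact fun y hy =>
        Or.inr (Or.inl (List.mem_append_right _ (P.tree.mem_pointList.2 hy)))
    · intro y hy
      rcases List.mem_append.1 hy with hy | hy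
      · exact h.rol y hy
      · have hyE := P.tree.mem_pointList.1 hy
        exact hit.mem_answer hk hv h.isEntry_self (h.lists E).2 hyE (h.exists_mem_NNU hyE)
  · refine h.settle rfl rfl rfl ?_ ?_ h.col h.rol ?_
    · rintro y (hy | hy | ⟨F, hF, hy⟩)
      · exact Or.inl hy
      · exact Or.inr (Or.inl hy)
      · exact Or.inr (Or.inr ⟨F, List.mem_append_left _ hF, hy⟩)
    · exact fun y hy =>
        Or.inr (Or.inr ⟨E, List.mem_append_right _ (List.mem_singleton.2 rfl), hy⟩)
    · intro F hF
      rcases List.mem_append.1 hF with hF | hF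
      · exact h.pel F hF
      · rw [List.mem_singleton.1 hF]
        exact ⟨h.isEntry_self, fun y hy =>
          drop.notMem_answer hk hv h.isEntry_self (h.lists E).1 hy⟩
  · cases E with
    | point x =>
      refine h.settle rfl rfl rfl ?_ ?_ ?_ h.rol h.pel
      · rintro y (hy | hy)
        · exact Or.inl (List.mem_append_left _ hy)
        · exact Or.inr hy
      · intro y hy
        rw [IndexTree.points_point, Set.mem_singleton_iff] at hy
        exact Or.inl (List.mem_append_right _ (List.mem_singleton.2 hy))
      · intro y hy
        rcases List.mem_append.1 hy with hy | hy
        · exact h.col y hy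
        · rw [List.mem_singleton.1 hy]
          exact h.isEntry_self
    | inner i => exact h.enqueueAll

theorem MainInvariant.mainBody [Finite I] {Sim : X → X → ℝ} (hk : 1 ≤ P.k)
    (hv : P.ValidBounds Sim) {s : State X I} (h : P.MainInvariant Sim s) {E : Entry X I}
    {rest : List (Entry X I)} (hU : s.U = E :: rest) :
    P.MainInvariant Sim (P.mainBody E rest s) :=
  (h.beforeTest hU).testEntry hk hv

theorem MainInvariant.mainLoop [Finite I] {Sim : X → X → ℝ} (hk : 1 ≤ P.k)
    (hv : P.ValidBounds Sim) {s t : State X I} (h : P.MainInvariant Sim s)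
    (hst : P.MainLoop s t) : P.MainInvariant Sim t ∧ t.U = [] := by
  induction hst with
  | done s hs => exact ⟨h, hs⟩
  | iter s t E rest hU _ ih => exact ih (h.mainBody hk hv hU)

theorem U_mainBody [Finite I] (E : Entry X I) (rest : List (Entry X I)) (s : State X I) :
    ∀ A ∈ (P.mainBody E rest s).U, A ∈ rest ∨ P.tree.IsParent E A := by
  have hU : (P.beforeTest E rest s).U = rest := (sameQueues_beforeTest E rest s).U
  change ∀ A ∈ (P.testEntry E (P.beforeTest E rest s)).U, _
  unfold testEntry
  split_ifs
  · exact fun A hA => Or.inl (hU ▸ hA)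
  · exact fun A hA => Or.inl (hU ▸ hA)
  · cases E with
    | point x => exact fun A hA => Or.inl (hU ▸ hA)
    | inner i =>
      intro A hA
      change A ∈ (P.enqueueAll _ _ _).U at hA
      rw [U_enqueueAll, hU, List.mem_append] at hA
      exact hA.imp_right fun hA => ⟨i, rfl, hA⟩

/-! ### Termination of the main loop. -/

/-- The entries in the subtrees of the entries of a queue. -/
def pending (P : Input X I) (L : List (Entry X I)) : Set (Entry X I) :=
  {F | ∃ A ∈ L, P.tree.InSubtree A F}

theorem finite_pending [Finite I] (L : List (Entry X I)) : (P.pending L).Finite := by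
  have hL : P.pending L = ⋃ A ∈ {A | A ∈ L}, {F | P.tree.InSubtree A F} := by
    ext F
    simp [pending]
  rw [hL]
  exact (List.finite_toSet L).biUnion fun A _ => P.tree.finite_subtree A

/-- The dequeued entry itself disappears: it is not below the remaining queue by apartness, nor
below its own children by acyclicity. -/
theorem MainInvariant.pending_ssubset [Finite I] {Sim : X → X → ℝ} {s : State X I}
    (h : P.MainInvariant Sim s) {E : Entry X I} {rest : List (Entry X I)}
    (hU : s.U = E :: rest) : P.pending (P.mainBody E rest s).U ⊂ P.pending s.U := by
  have hap := h.apart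
  rw [hU, List.pairwise_cons] at hap
  rw [hU]
  refine ⟨?_, fun hsub => ?_⟩
  · rintro F ⟨A, hA, hF⟩
    rcases U_mainBody E rest s A hA with hA | hA
    · exact ⟨A, List.mem_cons_of_mem _ hA, hF⟩
    · exact ⟨E, List.mem_cons_self, Relation.ReflTransGen.head hA hF⟩
  · obtain ⟨A, hA, hAE⟩ := hsub ⟨E, List.mem_cons_self, Relation.ReflTransGen.refl⟩
    rcases U_mainBody E rest s A hA with hA | hA
    · exact (hap.1 A hA).2 hAE
    · exact P.tree.not_inSubtree_of_isParent hA hAE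

theorem MainInvariant.exists_mainLoop [Finite I] {Sim : X → X → ℝ} (hk : 1 ≤ P.k)
    (hv : P.ValidBounds Sim) {s : State X I} (h : P.MainInvariant Sim s) :
    ∃ t, P.MainLoop s t := by
  induction hn : (P.pending s.U).ncard using Nat.strong_induction_on generalizing s with
  | _ n ih =>
    cases hU : s.U with
    | nil => exact ⟨s, MainLoop.done s hU⟩
    | cons E rest =>
      subst hn
      obtain ⟨t, ht⟩ := ih _ (Set.ncard_lt_ncard (h.pending_ssubset hU) (finite_pending _))
        (h.mainBody hk hv hU) rfl
      exact ⟨t, MainLoop.iter s t E rest hU ht⟩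

/-! ### The final verification. -/

/-- The entry `E` is updated with all entries of `L`. -/
noncomputable def updateAll (P : Input X I) (E : Entry X I) (L : List (Entry X I))
    (s : State X I) : State X I :=
  L.foldl (fun s F => P.update E F s) s

theorem sameQueues_updateAll (E : Entry X I) (L : List (Entry X I)) (s : State X I) :
    SameQueues s (P.updateAll E L s) := by
  induction L generalizing s with
  | nil => exact SameQueues.refl s
  | cons F L ih => exact (sameQueues_update E F s).trans (ih _)

theorem WellFormedLists.updateAll_point [Finite I] {s : State X I} (h : P.WellFormedLists s)
    (o : X) {L : List (Entry X I)} (hL : ∀ F ∈ L, P.tree.IsEntry F) :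
    P.WellFormedLists (P.updateAll (Entry.point o) L s) := by
  induction L generalizing s with
  | nil => exact h
  | cons F L ih =>
    refine ih (h.update (hL F List.mem_cons_self) ?_)
      fun G hG => hL G (List.mem_cons_of_mem _ hG)
    by_cases ho : o ∈ P.tree.points F
    · exact Or.inr (by simpa using ho)
    · refine Or.inl ?_
      rintro ⟨x, hx, hxF⟩
      rw [IndexTree.points_point, Set.mem_singleton_iff] at hx
      exact ho (hx ▸ hxF)

theorem not_overlap_point {x y : X} (h : x ≠ y) :
    ¬ P.tree.Overlap (Entry.point x) (Entry.point y) := by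
  rintro ⟨z, hx, hy⟩
  rw [IndexTree.points_point, Set.mem_singleton_iff] at hx hy
  exact h (hx.symm.trans hy)

/-- When only points are inserted, a listed point is evicted only by a copy of itself, which takes
its place. -/
theorem exists_point_mem_updateAll {s : State X I} {E : Entry X I} {L : List (Entry X I)}
    (hL : ∀ F ∈ L, ∃ x, F = Entry.point x) {y : X}
    (hy : ((∃ m, (Entry.point y, m) ∈ s.NNL E) ∧ ∃ m, (Entry.point y, m) ∈ s.NNU E) ∨
      Entry.point y ∈ L) :
    (∃ m, (Entry.point y, m) ∈ (P.updateAll E L s).NNL E) ∧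
      ∃ m, (Entry.point y, m) ∈ (P.updateAll E L s).NNU E := by
  induction L generalizing s with
  | nil => exact hy.resolve_right List.not_mem_nil
  | cons F L ih =>
    refine ih (s := P.update E F s) (fun G hG => hL G (List.mem_cons_of_mem _ hG)) ?_
    obtain ⟨x, rfl⟩ := hL F List.mem_cons_self
    by_cases hyx : y = x
    · subst hyx
      exact Or.inl ⟨exists_mem_NNL_update_self _ _ _, exists_mem_NNU_update_self _ _ _⟩
    · rcases hy with ⟨⟨m, hm⟩, ⟨n, hn⟩⟩ | hy
      · exact Or.inl ⟨⟨m, mem_NNL_update hm fun _ => not_overlap_point hyx⟩,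
          ⟨n, mem_NNU_update hn fun _ => not_overlap_point hyx⟩⟩
      · refine Or.inr ((List.mem_cons.1 hy).resolve_left fun h => hyx ?_)
        injection h

/-- The invariant of the verification loop. -/
structure VerifyInvariant (P : Input X I) (Sim : X → X → ℝ) (s : State X I) : Prop where
  lists : P.WellFormedLists s
  cover : ∀ y ∈ P.tree.data, y ∈ s.COL ∨ y ∈ s.ROL ∨ Entry.point y ∈ s.PEL
  col : ∀ y ∈ s.COL, y ∈ P.tree.data
  rol : ∀ y ∈ s.ROL, y ∈ P.answer Sim
  pel : ∀ F ∈ s.PEL, ∃ y, F = Entry.point y ∧ y ∈ P.tree.data ∧ y ∉ P.answer Sim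

theorem MainInvariant.flattenPEL [Finite I] {Sim : X → X → ℝ} {s : State X I}
    (h : P.MainInvariant Sim s) (hU : s.U = []) :
    P.VerifyInvariant Sim (P.flattenPEL s) where
  lists := h.lists
  cover y hy := by
    rcases h.cover y hy with ⟨B, hB, -⟩ | ⟨hc | hr | ⟨F, hF, hyF⟩, -⟩
    · simp [hU] at hB
    · exact Or.inl hc
    · exact Or.inr (Or.inl hr)
    · exact Or.inr (Or.inr (List.mem_flatMap.2
        ⟨F, hF, List.mem_map_of_mem (P.tree.mem_pointList.2 hyF)⟩))
  col := h.col
  rol := h.rol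
  pel F hF := by
    obtain ⟨G, hG, hF⟩ := List.mem_flatMap.1 hF
    obtain ⟨y, hy, rfl⟩ := List.mem_map.1 hF
    have hyG := P.tree.mem_pointList.1 hy
    exact ⟨y, rfl, P.tree.points_subset_data (h.pel G hG).1 hyG, (h.pel G hG).2 y hyG⟩

theorem sameQueues_verifyUpdate (o : X) (s : State X I) :
    SameQueues s (P.verifyUpdate o s) :=
  sameQueues_updateAll _ _ s

theorem VerifyInvariant.verifyUpdate [Finite I] {Sim : X → X → ℝ} {s : State X I}
    (h : P.VerifyInvariant Sim s) (o : X) :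
    P.VerifyInvariant Sim (P.verifyUpdate o s) ∧ ∀ y ∈ P.tree.data, y ≠ o →
      (∃ m, (Entry.point y, m) ∈ (P.verifyUpdate o s).NNL (Entry.point o)) ∧
        ∃ m, (Entry.point y, m) ∈ (P.verifyUpdate o s).NNU (Entry.point o) := by
  classical
  obtain ⟨-, qC, qR, qP⟩ := sameQueues_verifyUpdate (P := P) o s
  have hL : ∀ F ∈ s.ROL.map Entry.point ++ s.PEL ++
      (s.COL.filter (fun c => c ≠ o)).map Entry.point, ∃ y ∈ P.tree.data, F = Entry.point y := by
    intro F hF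
    simp only [List.mem_append, List.mem_map, List.mem_filter] at hF
    rcases hF with (⟨y, hy, rfl⟩ | hF) | ⟨y, ⟨hy, -⟩, rfl⟩
    · exact ⟨y, (h.rol y hy).1, rfl⟩
    · obtain ⟨y, rfl, hy, -⟩ := h.pel F hF
      exact ⟨y, hy, rfl⟩
    · exact ⟨y, h.col y hy, rfl⟩
  refine ⟨⟨?_, by rw [qC, qR, qP]; exact h.cover, by rw [qC]; exact h.col,
    by rw [qR]; exact h.rol, by rw [qP]; exact h.pel⟩, ?_⟩
  · refine h.lists.updateAll_point o fun F hF => ?_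
    obtain ⟨y, hy, rfl⟩ := hL F hF
    exact hy
  · intro y hy hyo
    refine exists_point_mem_updateAll (fun F hF => ?_) (Or.inr ?_)
    · obtain ⟨y, -, rfl⟩ := hL F hF
      exact ⟨y, rfl⟩
    · simp only [List.mem_append, List.mem_map, List.mem_filter]
      rcases h.cover y hy with hc | hr | hp
      · exact Or.inr ⟨y, ⟨hc, by simpa using hyo⟩, rfl⟩
      · exact Or.inl (Or.inl ⟨y, hr, rfl⟩)
      · exact Or.inl (Or.inr hp)

theorem VerifyInvariant.verifyTest [Finite I] {Sim : X → X → ℝ} (hk : 1 ≤ P.k)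
    (hv : P.ValidBounds Sim) {s : State X I} (h : P.VerifyInvariant Sim s) {o : X}
    (ho : o ∈ P.tree.data) (hcov : ∀ y ∈ P.tree.data, y ≠ o →
      ∃ m, (Entry.point y, m) ∈ s.NNU (Entry.point o)) :
    P.VerifyInvariant Sim (P.verifyTest o s) := by
  have hoo : o ∈ P.tree.points (Entry.point o) := by simp
  unfold Input.verifyTest
  split_ifs with hit drop
  · refine ⟨h.lists, fun y hy => ?_, fun y hy => h.col y (List.mem_of_mem_filter hy),
      fun y hy => ?_, h.pel⟩
    · by_cases hyo : y = o
      · exact Or.inr (Or.inl (List.mem_append_right _ (List.mem_singleton.2 hyo)))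
      · rcases h.cover y hy with hc | hr | hp
        · exact Or.inl (List.mem_filter.2 ⟨hc, by simpa using hyo⟩)
        · exact Or.inr (Or.inl (List.mem_append_left _ hr))
        · exact Or.inr (Or.inr hp)
    · rcases List.mem_append.1 hy with hy | hy
      · exact h.rol y hy
      · rw [List.mem_singleton.1 hy]
        refine hit.mem_answer hk hv ho (h.lists _).2 hoo fun z hz hzo => ?_
        obtain ⟨m, hm⟩ := hcov z hz hzo
        exact ⟨_, hm, by simp⟩
  · refine ⟨h.lists, fun y hy => ?_, fun y hy => h.col y (List.mem_of_mem_filter hy),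
      h.rol, fun F hF => ?_⟩
    · by_cases hyo : y = o
      · subst hyo
        exact Or.inr (Or.inr (List.mem_append_right _ (List.mem_singleton.2 rfl)))
      · rcases h.cover y hy with hc | hr | hp
        · exact Or.inl (List.mem_filter.2 ⟨hc, by simpa using hyo⟩)
        · exact Or.inr (Or.inl hr)
        · exact Or.inr (Or.inr (List.mem_append_left _ hp))
    · rcases List.mem_append.1 hF with hF | hF
      · exact h.pel F hF
      · exact ⟨o, List.mem_singleton.1 hF, ho,
          drop.notMem_answer hk hv ho (h.lists _).1 hoo⟩
  · exact h

theorem VerifyInvariant.verifyStep [Finite I] {Sim : X → X → ℝ} (hk : 1 ≤ P.k)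
    (hv : P.ValidBounds Sim) {s : State X I} (h : P.VerifyInvariant Sim s) {o : X}
    (ho : o ∈ P.tree.data) : P.VerifyInvariant Sim (P.verifyTest o (P.verifyUpdate o s)) :=
  (h.verifyUpdate o).1.verifyTest hk hv ho fun y hy hyo => ((h.verifyUpdate o).2 y hy hyo).2

/-- The candidates of `L` are treated one after the other. -/
noncomputable def verifyAll (P : Input X I) (L : List X) (s : State X I) : State X I :=
  L.foldl (fun s o => P.verifyTest o (P.verifyUpdate o s)) s

theorem VerifyInvariant.verifyAll [Finite I] {Sim : X → X → ℝ} (hk : 1 ≤ P.k)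
    (hv : P.ValidBounds Sim) {s : State X I} (h : P.VerifyInvariant Sim s) {L : List X}
    (hL : ∀ o ∈ L, o ∈ P.tree.data) : P.VerifyInvariant Sim (P.verifyAll L s) := by
  induction L generalizing s with
  | nil => exact h
  | cons o L ih =>
    exact ih (h.verifyStep hk hv (hL o List.mem_cons_self))
      fun y hy => hL y (List.mem_cons_of_mem _ hy)

theorem VerifyInvariant.verifyLoop [Finite I] {Sim : X → X → ℝ} (hk : 1 ≤ P.k)
    (hv : P.ValidBounds Sim) {s t : State X I} (h : P.VerifyInvariant Sim s)
    (hst : P.VerifyLoop s t) : P.VerifyInvariant Sim t ∧ t.COL = [] := by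
  induction hst with
  | done s hs => exact ⟨h, hs⟩
  | iter s t _ _ ih => exact ih (h.verifyAll hk hv h.col)

theorem VerifyInvariant.setOf_mem_ROL {Sim : X → X → ℝ} {s : State X I}
    (h : P.VerifyInvariant Sim s) (hs : s.COL = []) : {x | x ∈ s.ROL} = P.answer Sim := by
  ext y
  refine ⟨h.rol y, fun hy => ?_⟩
  rcases h.cover y hy.1 with hc | hr | hp
  · simp [hs] at hc
  · exact hr
  · obtain ⟨z, hz, -, hn⟩ := h.pel _ hp
    cases hz
    exact (hn hy).elim

theorem Returns.eq_answer [Finite I] {Sim : X → X → ℝ} (hk : 1 ≤ P.k)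
    (hv : P.ValidBounds Sim) {R : Set X} (h : P.Returns R) : R = P.answer Sim := by
  obtain ⟨s, t, hs, ht, rfl⟩ := h
  obtain ⟨hm, hU⟩ := (mainInvariant_initialState Sim).mainLoop hk hv hs
  obtain ⟨hf, hC⟩ := (hm.flattenPEL hU).verifyLoop hk hv ht
  exact hf.setOf_mem_ROL hC

/-! ### Termination of the verification. -/

/-- With exact point similarities, a candidate whose NN-lists contain all other points is a hit
or a drop. -/
theorem isHit_or_isDrop [Finite I] {Sim : X → X → ℝ} (hk : 1 ≤ P.k)
    (hx : P.ExactOnPoints Sim) {s : State X I} (h : P.WellFormedLists s) {o : X}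
    (ho : o ∈ P.tree.data) (hcov : ∀ y ∈ P.tree.data, y ≠ o →
      (∃ m, (Entry.point y, m) ∈ s.NNL (Entry.point o)) ∧
        ∃ m, (Entry.point y, m) ∈ s.NNU (Entry.point o)) :
    P.IsHit s (Entry.point o) ∨ P.IsDrop s (Entry.point o) := by
  refine or_iff_not_imp_left.2 fun hit => ?_
  have hoo : o ∈ P.tree.points (Entry.point o) := by simp
  simp only [IsHit, not_forall, not_lt, exists_prop] at hit
  -- At least `k` points are counted above `MinSim(o,Q)` in the upper list. It remains to find each
  -- of them above `MaxSim(o,Q)` in the lower list.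
  have hU := ((h (Entry.point o)).2.exists_kthEntry_iff hk _ hoo).1 hit
  refine ((h (Entry.point o)).1.exists_kthEntry_iff hk _ hoo).2
    (hU.trans (Set.ncard_le_ncard ?_ ((h (Entry.point o)).1.ncard_pointsAbove _ hoo).1))
  rintro y ⟨hyo, t, ht, hθ, hyt⟩
  have hyD := P.tree.points_subset_data ((h (Entry.point o)).2.isEntry t ht) hyt
  obtain ⟨⟨m, hm⟩, ⟨n, hn⟩⟩ := hcov y hyD hyo
  -- The upper list also contains `y` as a single point, so by disjointness the entry containing `y`
  -- is that point. This is what makes exactness applicable.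
  have hty : t = (Entry.point y, n) :=
    (h (Entry.point o)).2.eq_of_overlap ht hn ⟨y, hyt, by simp⟩
  subst hty
  refine ⟨hyo, _, hm, ?_, by simp⟩
  rw [(hx o ho y (Or.inl hyD)).1, (hx o ho _ (Or.inr rfl)).2]
  rwa [(hx o ho y (Or.inl hyD)).2, (hx o ho _ (Or.inr rfl)).1] at hθ

theorem VerifyInvariant.mem_COL_verifyStep [Finite I] {Sim : X → X → ℝ} (hk : 1 ≤ P.k)
    (hx : P.ExactOnPoints Sim) {s : State X I} (h : P.VerifyInvariant Sim s) {o : X}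
    (ho : o ∈ P.tree.data) {y : X}
    (hy : y ∈ (P.verifyTest o (P.verifyUpdate o s)).COL) : y ∈ s.COL ∧ y ≠ o := by
  obtain ⟨hu, hcov⟩ := h.verifyUpdate o
  have hC := (sameQueues_verifyUpdate (P := P) o s).COL
  unfold Input.verifyTest at hy
  split_ifs at hy with hit drop
  · simpa [hC] using hy
  · simpa [hC] using hy
  · exact ((isHit_or_isDrop hk hx hu.lists ho hcov).elim hit drop).elim

theorem VerifyInvariant.mem_COL_verifyAll [Finite I] {Sim : X → X → ℝ} (hk : 1 ≤ P.k)
    (hv : P.ValidBounds Sim) (hx : P.ExactOnPoints Sim) {s : State X I}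
    (h : P.VerifyInvariant Sim s) {L : List X} (hL : ∀ o ∈ L, o ∈ P.tree.data) {y : X}
    (hy : y ∈ (P.verifyAll L s).COL) : y ∈ s.COL ∧ y ∉ L := by
  induction L generalizing s with
  | nil => exact ⟨hy, List.not_mem_nil⟩
  | cons o L ih =>
    have ho := hL o List.mem_cons_self
    obtain ⟨h1, h2⟩ := ih (h.verifyStep hk hv ho) (fun z hz => hL z (List.mem_cons_of_mem _ hz)) hy
    obtain ⟨h3, h4⟩ := h.mem_COL_verifyStep hk hx ho h1
    exact ⟨h3, by simp [h2, h4]⟩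

theorem VerifyInvariant.exists_verifyLoop [Finite I] {Sim : X → X → ℝ} (hk : 1 ≤ P.k)
    (hv : P.ValidBounds Sim) (hx : P.ExactOnPoints Sim) {s : State X I}
    (h : P.VerifyInvariant Sim s) : ∃ t, P.VerifyLoop s t := by
  by_cases hs : s.COL = []
  · exact ⟨s, VerifyLoop.done s hs⟩
  -- One pass suffices: each treated candidate leaves the list and none is ever added.
  · refine ⟨_, VerifyLoop.iter s _ hs (VerifyLoop.done _ ?_)⟩
    refine List.eq_nil_iff_forall_not_mem.2 fun y hy => ?_
    obtain ⟨h1, h2⟩ := h.mem_COL_verifyAll hk hv hx h.col hy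
    exact h2 h1

theorem returns_answer [Finite I] {Sim : X → X → ℝ} (hk : 1 ≤ P.k) (hv : P.ValidBounds Sim)
    (hx : P.ExactOnPoints Sim) : P.Returns (P.answer Sim) := by
  have h0 := mainInvariant_initialState (P := P) Sim
  obtain ⟨s, hs⟩ := h0.exists_mainLoop hk hv
  obtain ⟨hm, hU⟩ := h0.mainLoop hk hv hs
  have hf := hm.flattenPEL hU
  obtain ⟨t, ht⟩ := hf.exists_verifyLoop hk hv hx
  obtain ⟨hg, hC⟩ := hf.verifyLoop hk hv ht
  exact ⟨s, t, hs, ht, (hg.setOf_mem_ROL hC).symm⟩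

end Input

end RkNN

theorem mainTheorem1 {X I : Type*} [Finite I] (P : RkNN.Input X I) (Sim : X → X → ℝ)
    (hk : 1 ≤ P.k) (hvalid : P.ValidBounds Sim) :
    (∀ R : Set X, P.Returns R → R = RkNN.reverseKNN Sim P.tree.data P.k P.query) ∧
    (P.ExactOnPoints Sim →
      P.Returns (RkNN.reverseKNN Sim P.tree.data P.k P.query)) :=
  ⟨fun _ hR => hR.eq_answer hk hvalid, fun hx => RkNN.Input.returns_answer hk hvalid hx⟩
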